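/- Let $k$ be an algebraically closed field of characteristic $p>0$. Homomorphisms below are homomorphisms of algebraic groups over $k$. Let $\mathrm B(2,k)\subset \mathrm{SL}(2,k)$ be the subgroup of upper triangular matrices and $\jmath:\mathbb G_a\rtimes\mathbb G_m\to \mathrm B(2,k)$, $\jmath(t,u)=\begin{pmatrix}u&tu^{-1}\\0&u^{-1}\end{pmatrix}$. Consider the following thirteen forms. In each, the $e_i$ are non-negative integers; write $q_i:=p^{e_i}$ and $E_{ij}$ for the matrix units. The form $(\nu)$ gives integers $d_1,d_2$ and a map $\varphi^*:\mathbb G_a\to\mathrm{SL}(4,k)$, and $(\nu^*)$ gives a map $\sigma^*:\mathrm{SL}(2,k)\to \mathrm{SL}(4,k)$, written as $\sigma^*\begin{pmatrix}a&b\\c&d\end{pmatrix}$. In the forms other than (IV) and (XV) we put $q:=p^{e_1}$ (in (XXIV): $q:=p^{e_2}$) and $A:=a^{q},\ B:=b^{q},\ C:=c^{q},\ D:=d^{q},\ T:=t^{q}$; in (IV) and (XV) we put $A_i:=a^{q_i},\ B_i:=b^{q_i},\ C_i:=c^{q_i},\ D_i:=d^{q_i},\ T_i:=t^{q_i}$.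 * (I) $p\ge5$; $d_1=3q$, $d_2=q$; $\varphi^*(t)=\begin{pmatrix}1&T&\frac12T^2&\frac16T^3\\0&1&T&\frac12T^2\\0&0&1&T\\0&0&0&1\end{pmatrix}$; $\sigma^*=\begin{pmatrix}A^3&A^2B&\frac12AB^2&\frac16B^3\\3A^2C&A(AD+2BC)&B(AD+\frac12BC)&\frac12B^2D\\6AC^2&4C(AD+\frac12BC)&D(AD+2BC)&BD^2\\6C^3&6C^2D&3CD^2&D^3\end{pmatrix}$. * (II) $p=3$; $d_1=3q$, $d_2=q$; $\varphi^*(t)=\begin{pmatrix}1&T&\frac12T^2&T^3\\0&1&T&0\\0&0&1&0\\0&0&0&1\end{pmatrix}$; $\sigma^*=\begin{pmatrix}A^3&A^2B&\frac12AB^2&B^3\\0&A&B&0\\0&C&D&0\\C^3&C^2D&\frac12CD^2&D^3\end{pmatrix}$. * (IV) $e_2>e_1\ge0$; $d_1=q_1+q_2$, $d_2=q_2-q_1$; $\varphi^*(t)=\begin{pmatrix}1&T_1&T_2&T_1T_2\\0&1&0&T_2\\0&0&1&T_1\\0&0&0&1\end{pmatrix}$; $\sigma^*=\begin{pmatrix}A_2&B_2\\C_2&D_2\end{pmatrix}\otimes\begin{pmatrix}A_1&B_1\\C_1&D_1\end{pmatrix}$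 (Kronecker product). * (V) $p=2$; $d_1=2q$, $d_2=0$; $\varphi^*(t)=I_4+T(E_{12}+E_{34})+T^2E_{14}$; $\sigma^*=\begin{pmatrix}A^2&AB&0&B^2\\0&1&0&0\\AC&BC&1&BD\\C^2&CD&0&D^2\end{pmatrix}$. * (VII) $p=3$; $d_1=3q$, $d_2=q$; $\varphi^*(t)=I_4+T(E_{23}+E_{34})+\frac12T^2E_{24}+T^3E_{14}$; $\sigma^*=\begin{pmatrix}A^3&0&0&B^3\\\frac12A^2C&A&B&\frac12B^2D\\AC^2&C&D&BD^2\\C^3&0&0&D^3\end{pmatrix}$. * (IX) $p\ge3$; $d_1=2q$, $d_2=0$; $\varphi^*(t)=I_4+T(E_{12}+E_{24})+\frac12T^2E_{14}$; $\sigma^*=\begin{pmatrix}A^2&AB&0&\frac12B^2\\2AC&AD+BC&0&BD\\0&0&1&0\\2C^2&2CD&0&D^2\end{pmatrix}$. * (XI) $p=2$; $d_1=2q$, $d_2=0$; $\varphi^*(t)=I_4+TE_{12}+T^2E_{14}$; $\sigma^*=\begin{pmatrix}A^2&AB&0&B^2\\0&1&0&0\\0&0&1&0\\C^2&CD&0&D^2\end{pmatrix}$.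 * (XV) $e_2\ge e_3\ge0$; $d_1=q_2$, $d_2=q_3$; $\varphi^*(t)=I_4+T_2E_{14}+T_3E_{23}$; $\sigma^*=\begin{pmatrix}A_2&0&0&B_2\\0&A_3&B_3&0\\0&C_3&D_3&0\\C_2&0&0&D_2\end{pmatrix}$. * (XIX) $p=2$; $d_1=2q$, $d_2=0$; $\varphi^*(t)=I_4+TE_{34}+T^2E_{14}$; $\sigma^*=\begin{pmatrix}A^2&0&0&B^2\\0&1&0&0\\AC&0&1&BD\\C^2&0&0&D^2\end{pmatrix}$. * (XXI) $p=2$; $d_1=2q$, $d_2=0$; $\varphi^*(t)=I_4+T(E_{13}+E_{24})+T^2E_{14}$; $\sigma^*=\begin{pmatrix}A^2&0&AB&B^2\\AC&1&BC&BD\\0&0&1&0\\C^2&0&CD&D^2\end{pmatrix}$. * (XXII) $d_1=d_2=q$; $\varphi^*(t)=I_4+T(E_{13}+E_{24})$; $\sigma^*=\begin{pmatrix}A&0&B&0\\0&A&0&B\\C&0&D&0\\0&C&0&D\end{pmatrix}$. * (XXIV) $d_1=q$, $d_2=0$; $\varphi^*(t)=I_4+TE_{14}$; $\sigma^*=\begin{pmatrix}A&0&0&B\\0&1&0&0\\0&0&1&0\\C&0&0&D\end{pmatrix}$.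 * (XXVI) $d_1=d_2=0$; $\varphi^*(t)=I_4$; $\sigma^*=I_4$. Let $\omega^*(u)=\mathrm{diag}(u^{d_1},u^{d_2},u^{-d_2},u^{-d_1})$ and let $\psi^*:\mathrm B(2,k)\to\mathrm{SL}(4,k)$ be defined by $\psi^*(\jmath(t,u))=\varphi^*(t)\,\omega^*(u)$. Then, for each of the thirteen forms and all values of its parameters, $\psi^*$ is a homomorphism, and: (1) $\sigma^*$ is a homomorphism $\mathrm{SL}(2,k)\to\mathrm{SL}(4,k)$ and $\sigma^*|_{\mathrm B(2,k)}=\psi^*$; (2) there exists a unique homomorphism $\widehat\sigma:\mathrm{SL}(2,k)\to\mathrm{SL}(4,k)$ with $\widehat\sigma|_{\mathrm B(2,k)}=\psi^*$. -/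

import Mathlib

/-- `SL(n, k)`. -/
abbrev SLn (n : ℕ) (k : Type*) [CommRing k] : Type _ := Matrix.SpecialLinearGroup (Fin n) k

/-- The Borel subgroup `B(2, k)` of upper triangular matrices of `SL(2, k)`. -/
def borelSL2 (k : Type*) [Field k] : Subgroup (SLn 2 k) where
  carrier := {A | A.1 1 0 = 0}
  mul_mem' := by
    intro A B hA hB
    simp only [Set.mem_ofPred_eq] at *
    simp [Matrix.mul_apply, Fin.sum_univ_two, hA, hB]
  one_mem' := by simp
  inv_mem' := by
    intro A hA
    simp only [Set.mem_ofPred_eq] at *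
    simp [Matrix.SpecialLinearGroup.SL2_inv_expl, hA]

/-- A map `f` from a closed subset `X` of the affine space of `m × m` matrices (embedded by `c`) to
`SL(n, k)` is a morphism of varieties: each entry of `f x` is a polynomial in the entries of the
matrix `c x`. -/
def IsRegularMap {k : Type*} [Field k] {X : Type*} {m n : ℕ} (c : X → Matrix (Fin m) (Fin m) k)
    (f : X → SLn n k) : Prop :=
  ∃ P : Fin n → Fin n → MvPolynomial (Fin m × Fin m) k,
    ∀ x i j, (f x).1 i j = MvPolynomial.eval (fun q => c x q.1 q.2) (P i j)

/-- Homomorphisms of algebraic groups from `SL(2, k)` to `SL(n, k)`. -/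
structure IsSLHom {k : Type*} [Field k] {n : ℕ} (σ : SLn 2 k → SLn n k) : Prop where
  map_mul : ∀ A B, σ (A * B) = σ A * σ B
  regular : IsRegularMap (fun A : SLn 2 k => A.1) σ

/-- Homomorphisms of algebraic groups from `B(2, k)` to `SL(n, k)`. -/
structure IsBorelHom {k : Type*} [Field k] {n : ℕ} (ψ : borelSL2 k → SLn n k) : Prop where
  map_mul : ∀ A B, ψ (A * B) = ψ A * ψ B
  regular : IsRegularMap (fun A : borelSL2 k => A.1.1) ψ

/-- The isomorphism `ȷ : 𝔾ₐ ⋊ 𝔾ₘ → B(2, k)`, `(t, u) ↦ (u, t u⁻¹; 0, u⁻¹)`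
(on underlying sets). -/
def jmath (k : Type*) [Field k] : k × kˣ ≃ borelSL2 k where
  toFun x := ⟨⟨!![(x.2 : k), x.1 * (x.2 : k)⁻¹; 0, (x.2 : k)⁻¹], by
    simp [Matrix.det_fin_two]⟩, by
    show (!![(x.2 : k), x.1 * (x.2 : k)⁻¹; 0, (x.2 : k)⁻¹] : Matrix (Fin 2) (Fin 2) k) 1 0 = 0
    simp⟩
  invFun A :=
    have h : A.1.1 0 0 * A.1.1 1 1 = 1 := by
      have h1 := A.1.2
      have h2 : A.1.1 1 0 = 0 := A.2
      rw [Matrix.det_fin_two, h2] at h1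
      simpa using h1
    (A.1.1 0 1 * A.1.1 0 0, ⟨A.1.1 0 0, A.1.1 1 1, h, by rw [mul_comm]; exact h⟩)
  left_inv := by
    rintro ⟨t, u⟩
    ext <;> simp
  right_inv := by
    rintro ⟨A, hA⟩
    have h2 : A.1 1 0 = 0 := hA
    have h : A.1 0 0 * A.1 1 1 = 1 := by
      have h1 := A.2
      rw [Matrix.det_fin_two, h2] at h1
      simpa using h1
    have h0 : A.1 0 0 ≠ 0 := left_ne_zero_of_mul_eq_one h
    have h3 : (A.1 0 0)⁻¹ = A.1 1 1 := inv_eq_of_mul_eq_one_right h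
    apply Subtype.ext
    apply Subtype.ext
    ext i j
    fin_cases i <;> fin_cases j
    · simp
    · simp [h0]
    · simpa using h2.symm
    · simpa using h3

/-- The morphism `ψ_{φ, ω} : 𝔾ₐ ⋊ 𝔾ₘ → SL(n, k)`, `(t, u) ↦ φ(t) ω(u)`. -/
def psiPair {k : Type*} [Field k] {n : ℕ} (φ : k → SLn n k) (ω : kˣ → SLn n k) :
    k × kˣ → SLn n k :=
  fun x => φ x.1 * ω x.2

/-- `ω(u) = diag(u^{d₁}, u^{d₂}, u^{-d₂}, u^{-d₁})`. -/
def omega {k : Type*} [Field k] (d₁ d₂ : ℤ) (u : kˣ) : SLn 4 k :=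
  ⟨Matrix.diagonal ![((u ^ d₁ : kˣ) : k), ((u ^ d₂ : kˣ) : k), ((u ^ (-d₂) : kˣ) : k),
      ((u ^ (-d₁) : kˣ) : k)], by
    rw [Matrix.det_diagonal, Fin.prod_univ_four]
    simp only [Matrix.cons_val]
    rw [← Units.val_mul, ← Units.val_mul, ← Units.val_mul, ← _root_.zpow_add, ← _root_.zpow_add,
      ← _root_.zpow_add, show d₁ + d₂ + -d₂ + -d₁ = 0 by ring, zpow_zero, Units.val_one]⟩

/-- The thirteen forms (ν), together with their parameters. -/
inductive BForm (p : ℕ) : Type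
  | I (e₁ : ℕ) (hp : 5 ≤ p)
  | II (e₁ : ℕ) (hp : p = 3)
  | IV (e₁ e₂ : ℕ) (he : e₁ < e₂)
  | V (e₁ f : ℕ) (hf : e₁ + 1 ≤ f)
  | VII (e₁ : ℕ) (hp : p = 3)
  | IX (e₁ : ℕ) (hp : 3 ≤ p)
  | XI (e₁ e₃ : ℕ) (he : e₁ + 1 ≤ e₃)
  | XV (e₂ e₃ : ℕ) (he : e₃ ≤ e₂)
  | XIX (e₁ e₃ : ℕ) (he : e₁ + 1 ≤ e₃)
  | XXI (e₁ : ℕ) (hp : p = 2)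
  | XXII (e₁ : ℕ) (d₁ : ℤ) (hd : (p : ℤ) ^ e₁ ≤ d₁) (hd' : d₁ ≤ 2 * (p : ℤ) ^ e₁)
  | XXIV (e₂ : ℕ) (d₂ : ℤ) (hd : 0 ≤ d₂) (hd' : d₂ ≤ (p : ℤ) ^ e₂)
  | XXVI (d₁ d₂ : ℤ) (hd : 0 ≤ d₂) (hd' : d₂ ≤ d₁)

namespace BForm

variable {p : ℕ}

/-- The integer `d₁` of the form. -/
def d₁ : BForm p → ℤ
  | I e₁ _ => 3 * (p : ℤ) ^ e₁
  | II e₁ _ => (p : ℤ) ^ (e₁ + 1)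
  | IV e₁ e₂ _ => (p : ℤ) ^ e₁ + (p : ℤ) ^ e₂
  | V _ f _ => (p : ℤ) ^ f
  | VII e₁ _ => (p : ℤ) ^ (e₁ + 1)
  | IX e₁ _ => 2 * (p : ℤ) ^ e₁
  | XI _ e₃ _ => (p : ℤ) ^ e₃
  | XV e₂ _ _ => (p : ℤ) ^ e₂
  | XIX _ e₃ _ => (p : ℤ) ^ e₃
  | XXI e₁ _ => (p : ℤ) ^ (e₁ + 1)
  | XXII _ d₁ _ _ => d₁
  | XXIV e₂ _ _ _ => (p : ℤ) ^ e₂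
  | XXVI d₁ _ _ _ => d₁

/-- The integer `d₂` of the form. -/
def d₂ : BForm p → ℤ
  | I e₁ _ => (p : ℤ) ^ e₁
  | II e₁ _ => (p : ℤ) ^ e₁
  | IV e₁ e₂ _ => (p : ℤ) ^ e₂ - (p : ℤ) ^ e₁
  | V e₁ f _ => (p : ℤ) ^ f - 2 * (p : ℤ) ^ e₁
  | VII e₁ _ => (p : ℤ) ^ e₁
  | IX _ _ => 0
  | XI e₁ e₃ _ => (p : ℤ) ^ e₃ - 2 * (p : ℤ) ^ e₁
  | XV _ e₃ _ => (p : ℤ) ^ e₃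
  | XIX e₁ e₃ _ => (p : ℤ) ^ e₃ - 2 * (p : ℤ) ^ e₁
  | XXI _ _ => 0
  | XXII e₁ d₁ _ _ => 2 * (p : ℤ) ^ e₁ - d₁
  | XXIV _ d₂ _ _ => d₂
  | XXVI _ d₂ _ _ => d₂

/-- The matrix `φ*(t)` of the form. -/
def phiMatrix {k : Type*} [Field k] (t : k) : BForm p → Matrix (Fin 4) (Fin 4) k
  | I e₁ _ =>
    !![1, t ^ p ^ e₁, 1 / 2 * t ^ (2 * p ^ e₁), 1 / 6 * t ^ (3 * p ^ e₁);
       0, 1, t ^ p ^ e₁, 1 / 2 * t ^ (2 * p ^ e₁);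
       0, 0, 1, t ^ p ^ e₁;
       0, 0, 0, 1]
  | II e₁ _ =>
    !![1, t ^ p ^ e₁, 1 / 2 * t ^ (2 * p ^ e₁), t ^ p ^ (e₁ + 1);
       0, 1, t ^ p ^ e₁, 0;
       0, 0, 1, 0;
       0, 0, 0, 1]
  | IV e₁ e₂ _ =>
    !![1, t ^ p ^ e₁, t ^ p ^ e₂, t ^ (p ^ e₁ + p ^ e₂);
       0, 1, 0, t ^ p ^ e₂;
       0, 0, 1, t ^ p ^ e₁;
       0, 0, 0, 1]
  | V e₁ f _ =>
    !![1, t ^ p ^ e₁, 0, t ^ p ^ f;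
       0, 1, 0, 0;
       0, 0, 1, t ^ p ^ e₁;
       0, 0, 0, 1]
  | VII e₁ _ =>
    !![1, 0, 0, t ^ p ^ (e₁ + 1);
       0, 1, t ^ p ^ e₁, 1 / 2 * t ^ (2 * p ^ e₁);
       0, 0, 1, t ^ p ^ e₁;
       0, 0, 0, 1]
  | IX e₁ _ =>
    !![1, t ^ p ^ e₁, 0, 1 / 2 * t ^ (2 * p ^ e₁);
       0, 1, 0, t ^ p ^ e₁;
       0, 0, 1, 0;
       0, 0, 0, 1]
  | XI e₁ e₃ _ =>
    !![1, t ^ p ^ e₁, 0, t ^ p ^ e₃;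
       0, 1, 0, 0;
       0, 0, 1, 0;
       0, 0, 0, 1]
  | XV e₂ e₃ _ =>
    !![1, 0, 0, t ^ p ^ e₂;
       0, 1, t ^ p ^ e₃, 0;
       0, 0, 1, 0;
       0, 0, 0, 1]
  | XIX e₁ e₃ _ =>
    !![1, 0, 0, t ^ p ^ e₃;
       0, 1, 0, 0;
       0, 0, 1, t ^ p ^ e₁;
       0, 0, 0, 1]
  | XXI e₁ _ =>
    !![1, 0, t ^ p ^ e₁, t ^ p ^ (e₁ + 1);
       0, 1, 0, t ^ p ^ e₁;
       0, 0, 1, 0;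
       0, 0, 0, 1]
  | XXII e₁ _ _ _ =>
    !![1, 0, t ^ p ^ e₁, 0;
       0, 1, 0, t ^ p ^ e₁;
       0, 0, 1, 0;
       0, 0, 0, 1]
  | XXIV e₂ _ _ _ =>
    !![1, 0, 0, t ^ p ^ e₂;
       0, 1, 0, 0;
       0, 0, 1, 0;
       0, 0, 0, 1]
  | XXVI _ _ _ _ => 1

theorem det_phiMatrix {k : Type*} [Field k] (t : k) (β : BForm p) : (β.phiMatrix t).det = 1 := by
  have key : ∀ x y z u v w : k,
      (!![1, x, y, z; 0, 1, u, v; 0, 0, 1, w; 0, 0, 0, 1] : Matrix (Fin 4) (Fin 4) k).det = 1 := by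
    intro x y z u v w
    simp [Matrix.det_succ_row_zero, Fin.sum_univ_succ, Fin.succAbove]
  cases β <;> simp only [phiMatrix, Matrix.det_one, key]

/-- `φ* : 𝔾ₐ → SL(4, k)`. -/
def phi {k : Type*} [Field k] (β : BForm p) (t : k) : SLn 4 k :=
  ⟨β.phiMatrix t, det_phiMatrix t β⟩

/-- `ψ* = ψ_{φ*, ω*} ∘ ȷ⁻¹ : B(2, k) → SL(4, k)`, where `(φ*, ω*)` is the pair of the given
form. -/
def psi {k : Type*} [Field k] (β : BForm p) : borelSL2 k → SLn 4 k :=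
  psiPair β.phi (omega β.d₁ β.d₂) ∘ (jmath k).symm

/-- The parameters of the form (ν) are those occurring in the form (ν*): `σ*` below is defined for
this `p` and these exponents, and its weights on the diagonal torus are `d₁, d₂, -d₂, -d₁`.
This cuts down the parameters only in the six cases that are listed. In the case XXII it also gives
`d₂ = p ^ e₁`. -/
def IsStarForm : BForm p → Prop
  | V e₁ f _ => p = 2 ∧ f = e₁ + 1
  | XI e₁ e₃ _ => p = 2 ∧ e₃ = e₁ + 1
  | XIX e₁ e₃ _ => p = 2 ∧ e₃ = e₁ + 1
  | XXII e₁ d₁ _ _ => d₁ = (p : ℤ) ^ e₁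
  | XXIV _ d₂ _ _ => d₂ = 0
  | XXVI d₁ d₂ _ _ => d₁ = 0 ∧ d₂ = 0
  | _ => True

/-- The matrix `σ*(a, b; c, d)` of the form (ν*). -/
def sigmaMatrix {k : Type*} [Field k] (a b c d : k) : BForm p → Matrix (Fin 4) (Fin 4) k
  | I e₁ _ =>
    !![a ^ (3 * p ^ e₁), a ^ (2 * p ^ e₁) * b ^ p ^ e₁,
         1 / 2 * a ^ p ^ e₁ * b ^ (2 * p ^ e₁), 1 / 6 * b ^ (3 * p ^ e₁);
       3 * a ^ (2 * p ^ e₁) * c ^ p ^ e₁, a ^ p ^ e₁ * (a * d + 2 * b * c) ^ p ^ e₁,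
         b ^ p ^ e₁ * (a * d + 1 / 2 * b * c) ^ p ^ e₁, 1 / 2 * b ^ (2 * p ^ e₁) * d ^ p ^ e₁;
       6 * a ^ p ^ e₁ * c ^ (2 * p ^ e₁), 4 * c ^ p ^ e₁ * (a * d + 1 / 2 * b * c) ^ p ^ e₁,
         d ^ p ^ e₁ * (a * d + 2 * b * c) ^ p ^ e₁, b ^ p ^ e₁ * d ^ (2 * p ^ e₁);
       6 * c ^ (3 * p ^ e₁), 6 * c ^ (2 * p ^ e₁) * d ^ p ^ e₁,
         3 * c ^ p ^ e₁ * d ^ (2 * p ^ e₁), d ^ (3 * p ^ e₁)]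
  | II e₁ _ =>
    !![a ^ p ^ (e₁ + 1), a ^ (2 * p ^ e₁) * b ^ p ^ e₁, 1 / 2 * a ^ p ^ e₁ * b ^ (2 * p ^ e₁),
         b ^ p ^ (e₁ + 1);
       0, a ^ p ^ e₁, b ^ p ^ e₁, 0;
       0, c ^ p ^ e₁, d ^ p ^ e₁, 0;
       c ^ p ^ (e₁ + 1), c ^ (2 * p ^ e₁) * d ^ p ^ e₁, 1 / 2 * c ^ p ^ e₁ * d ^ (2 * p ^ e₁),
         d ^ p ^ (e₁ + 1)]
  | IV e₁ e₂ _ =>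
    !![a ^ p ^ e₂ * a ^ p ^ e₁, a ^ p ^ e₂ * b ^ p ^ e₁, b ^ p ^ e₂ * a ^ p ^ e₁,
         b ^ p ^ e₂ * b ^ p ^ e₁;
       a ^ p ^ e₂ * c ^ p ^ e₁, a ^ p ^ e₂ * d ^ p ^ e₁, b ^ p ^ e₂ * c ^ p ^ e₁,
         b ^ p ^ e₂ * d ^ p ^ e₁;
       c ^ p ^ e₂ * a ^ p ^ e₁, c ^ p ^ e₂ * b ^ p ^ e₁, d ^ p ^ e₂ * a ^ p ^ e₁,
         d ^ p ^ e₂ * b ^ p ^ e₁;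
       c ^ p ^ e₂ * c ^ p ^ e₁, c ^ p ^ e₂ * d ^ p ^ e₁, d ^ p ^ e₂ * c ^ p ^ e₁,
         d ^ p ^ e₂ * d ^ p ^ e₁]
  | V e₁ _ _ =>
    !![a ^ p ^ (e₁ + 1), a ^ p ^ e₁ * b ^ p ^ e₁, 0, b ^ p ^ (e₁ + 1);
       0, 1, 0, 0;
       a ^ p ^ e₁ * c ^ p ^ e₁, b ^ p ^ e₁ * c ^ p ^ e₁, 1, b ^ p ^ e₁ * d ^ p ^ e₁;
       c ^ p ^ (e₁ + 1), c ^ p ^ e₁ * d ^ p ^ e₁, 0, d ^ p ^ (e₁ + 1)]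
  | VII e₁ _ =>
    !![a ^ p ^ (e₁ + 1), 0, 0, b ^ p ^ (e₁ + 1);
       1 / 2 * a ^ (2 * p ^ e₁) * c ^ p ^ e₁, a ^ p ^ e₁, b ^ p ^ e₁,
         1 / 2 * b ^ (2 * p ^ e₁) * d ^ p ^ e₁;
       a ^ p ^ e₁ * c ^ (2 * p ^ e₁), c ^ p ^ e₁, d ^ p ^ e₁, b ^ p ^ e₁ * d ^ (2 * p ^ e₁);
       c ^ p ^ (e₁ + 1), 0, 0, d ^ p ^ (e₁ + 1)]
  | IX e₁ _ =>
    !![a ^ (2 * p ^ e₁), a ^ p ^ e₁ * b ^ p ^ e₁, 0, 1 / 2 * b ^ (2 * p ^ e₁);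
       2 * a ^ p ^ e₁ * c ^ p ^ e₁, a ^ p ^ e₁ * d ^ p ^ e₁ + b ^ p ^ e₁ * c ^ p ^ e₁, 0,
         b ^ p ^ e₁ * d ^ p ^ e₁;
       0, 0, 1, 0;
       2 * c ^ (2 * p ^ e₁), 2 * c ^ p ^ e₁ * d ^ p ^ e₁, 0, d ^ (2 * p ^ e₁)]
  | XI e₁ _ _ =>
    !![a ^ (2 * p ^ e₁), a ^ p ^ e₁ * b ^ p ^ e₁, 0, b ^ (2 * p ^ e₁);
       0, 1, 0, 0;
       0, 0, 1, 0;
       c ^ (2 * p ^ e₁), c ^ p ^ e₁ * d ^ p ^ e₁, 0, d ^ (2 * p ^ e₁)]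
  | XV e₂ e₃ _ =>
    !![a ^ p ^ e₂, 0, 0, b ^ p ^ e₂;
       0, a ^ p ^ e₃, b ^ p ^ e₃, 0;
       0, c ^ p ^ e₃, d ^ p ^ e₃, 0;
       c ^ p ^ e₂, 0, 0, d ^ p ^ e₂]
  | XIX e₁ _ _ =>
    !![a ^ (2 * p ^ e₁), 0, 0, b ^ (2 * p ^ e₁);
       0, 1, 0, 0;
       a ^ p ^ e₁ * c ^ p ^ e₁, 0, 1, b ^ p ^ e₁ * d ^ p ^ e₁;
       c ^ (2 * p ^ e₁), 0, 0, d ^ (2 * p ^ e₁)]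
  | XXI e₁ _ =>
    !![a ^ (2 * p ^ e₁), 0, a ^ p ^ e₁ * b ^ p ^ e₁, b ^ (2 * p ^ e₁);
       a ^ p ^ e₁ * c ^ p ^ e₁, 1, b ^ p ^ e₁ * c ^ p ^ e₁, b ^ p ^ e₁ * d ^ p ^ e₁;
       0, 0, 1, 0;
       c ^ (2 * p ^ e₁), 0, c ^ p ^ e₁ * d ^ p ^ e₁, d ^ (2 * p ^ e₁)]
  | XXII e₁ _ _ _ =>
    !![a ^ p ^ e₁, 0, b ^ p ^ e₁, 0;
       0, a ^ p ^ e₁, 0, b ^ p ^ e₁;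
       c ^ p ^ e₁, 0, d ^ p ^ e₁, 0;
       0, c ^ p ^ e₁, 0, d ^ p ^ e₁]
  | XXIV e₂ _ _ _ =>
    !![a ^ p ^ e₂, 0, 0, b ^ p ^ e₂;
       0, 1, 0, 0;
       0, 0, 1, 0;
       c ^ p ^ e₂, 0, 0, d ^ p ^ e₂]
  | XXVI _ _ _ _ => 1

end BForm

/-! Existence is a computation. The map x ↦ x^q is a ring endomorphism of k, so the entries of σ*
are expressions in q-th powers that satisfy AD - BC = 1. Multiplicativity (`sigmaMatrix_mul`) and
determinant one (`det_sigmaMatrix`) become polynomial identities modulo this relation and p = 0. In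
the coordinates (t, u) on the Borel subgroup B, σ* is seen to equal ψ* (`sigmaMatrix_eq_psi_jmath`).
That ψ* is a homomorphism then follows by restriction.

Uniqueness is rigidity. If σ and τ agree on B, then g ↦ τ(g)σ(g)⁻¹ is invariant under right
translation by B, hence descends to SL(2)/B, the projective line. A morphism from there to an affine
variety is constant, and its value at 1 is 1. The proof works on two charts, `lowerUnipotent s` and
`weylChart s⁻¹`, which represent the same coset for s ≠ 0. Each entry is then a polynomial in s and
also a polynomial in s⁻¹, so it is constant (`Polynomial.eval_eq_of_eval_inv`). -/

/-! ### Rigidity: a homomorphism on SL(2) is determined on the Borel subgroup -/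

open Polynomial in
/-- Along a curve of matrices with polynomial entries, a regular map has polynomial entries. -/
theorem IsRegularMap.exists_polynomial {k X : Type*} [Field k] {m n : ℕ}
    {c : X → Matrix (Fin m) (Fin m) k} {f : X → SLn n k} (hf : IsRegularMap c f)
    (M : Matrix (Fin m) (Fin m) k[X]) (i j : Fin n) :
    ∃ Q : k[X], ∀ x s, c x = M.map (Polynomial.eval s) → (f x).1 i j = Q.eval s := by
  obtain ⟨P, hP⟩ := hf
  refine ⟨MvPolynomial.aeval (fun q => M q.1 q.2) (P i j), fun x s hx => ?_⟩
  rw [hP, hx, MvPolynomial.aeval_def, ← Polynomial.coe_evalRingHom, MvPolynomial.hom_eval₂]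
  have h : (Polynomial.evalRingHom s).comp (algebraMap k k[X]) = RingHom.id k := by
    ext x
    simp
  rw [h]
  rfl

open Polynomial in
/-- A function on the projective line that is polynomial on both standard charts is constant. -/
theorem Polynomial.eval_eq_of_eval_inv {k : Type*} [Field k] [Infinite k] {h r : k[X]}
    (H : ∀ s : k, s ≠ 0 → h.eval s = r.eval s⁻¹) (s : k) : h.eval s = h.eval 0 := by
  -- Clearing denominators in h(s) = r(1/s) gives an identity at every s ≠ 0, hence between
  -- polynomials since k is infinite.
  have key : X ^ r.natDegree * h = r.reverse := by
    refine Polynomial.eq_of_infinite_eval_eq _ _ ((Set.infinite_of_finite_compl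
      (s := {0}ᶜ) (by simp)).mono ?_)
    intro s hs
    have hs : s ≠ 0 := hs
    let : Invertible s⁻¹ := ⟨s, mul_inv_cancel₀ hs, inv_mul_cancel₀ hs⟩
    have := eval₂_reverse_mul_pow (RingHom.id k) s⁻¹ r
    simp only [Set.mem_ofPred_eq, eval_mul, eval_pow, eval_X, H s hs]
    rw [← eval₂_id, ← this, mul_left_comm, ← mul_pow, mul_inv_cancel₀ hs, one_pow, mul_one,
      eval₂_id]
    rfl
  -- Comparing degrees: deg r + deg h ≤ deg r.
  have hd : h.natDegree = 0 := by
    by_cases h0 : h = 0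
    · simp [h0]
    have h1 := congrArg natDegree key
    rw [natDegree_mul (pow_ne_zero _ X_ne_zero) h0, natDegree_X_pow] at h1
    have := reverse_natDegree_le r
    omega
  rw [eq_C_of_natDegree_eq_zero hd]
  simp

theorem SLn.mul_val {k : Type*} [Field k] {n : ℕ} (A B : SLn n k) : (A * B).1 = A.1 * B.1 := rfl

theorem SLn.inv_val_two {k : Type*} [Field k] (A : SLn 2 k) :
    (A⁻¹).1 = !![A.1 1 1, -A.1 0 1; -A.1 1 0, A.1 0 0] := by
  rw [Matrix.SpecialLinearGroup.SL2_inv_expl]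
  rfl

/-- The lower unitriangular matrix `(1, 0; s, 1)`. -/
def lowerUnipotent {k : Type*} [Field k] (s : k) : SLn 2 k :=
  ⟨!![1, 0; s, 1], by simp [Matrix.det_fin_two]⟩

theorem lowerUnipotent_inv {k : Type*} [Field k] (s : k) :
    (lowerUnipotent s)⁻¹ = lowerUnipotent (-s) := by
  apply Subtype.ext
  rw [SLn.inv_val_two]
  simp [lowerUnipotent]

/-- The matrix `(x, -1; 1, 0)`. -/
def weylChart {k : Type*} [Field k] (x : k) : SLn 2 k :=
  ⟨!![x, -1; 1, 0], by simp [Matrix.det_fin_two]⟩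

/-- The transition between the two charts of SL(2)/B: the coset is the line spanned by the first
column, and (1, s) is proportional to (s⁻¹, 1). -/
theorem lowerUnipotent_mem_mul_borel {k : Type*} [Field k] {s : k} (hs : s ≠ 0) :
    ∃ b : borelSL2 k, lowerUnipotent s = weylChart s⁻¹ * b.1 := by
  refine ⟨⟨(weylChart s⁻¹)⁻¹ * lowerUnipotent s, ?_⟩, by simp⟩
  change (((weylChart s⁻¹)⁻¹ * lowerUnipotent s : SLn 2 k)).1 1 0 = 0
  rw [SLn.mul_val, SLn.inv_val_two]
  simp [weylChart, lowerUnipotent, hs]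

/-- `SL(2, k)` is generated by the Borel subgroup and the lower unitriangular matrices. -/
theorem exists_borel_mul_lowerUnipotent_mul_borel {k : Type*} [Field k] (g : SLn 2 k) :
    ∃ (b : borelSL2 k) (s : k) (b' : borelSL2 k), g = b.1 * lowerUnipotent s * b'.1 := by
  have big : ∀ g : SLn 2 k, g.1 0 0 ≠ 0 →
      ∃ (s : k) (b' : borelSL2 k), g = lowerUnipotent s * b'.1 := by
    intro g hg
    -- With s = c/a, subtracting s times the first row from the second clears the lower left entry.
    refine ⟨g.1 1 0 / g.1 0 0, ⟨(lowerUnipotent (g.1 1 0 / g.1 0 0))⁻¹ * g, ?_⟩, by simp⟩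
    rw [lowerUnipotent_inv]
    change ((lowerUnipotent _ * g : SLn 2 k)).1 1 0 = 0
    rw [SLn.mul_val]
    simp [lowerUnipotent, Matrix.mul_apply, Fin.sum_univ_two, hg]
  by_cases hg : g.1 0 0 = 0
  · have hc : g.1 1 0 ≠ 0 := by
      intro hc
      have := g.2
      rw [Matrix.det_fin_two, hg, hc] at this
      simp at this
    -- If a = 0 then c ≠ 0, and adding the second row to the first moves c into the corner, which
    -- reduces to the big cell.
    let u : borelSL2 k := ⟨⟨!![1, 1; 0, 1], by simp [Matrix.det_fin_two]⟩, by
      change (!![1, 1; 0, 1] : Matrix (Fin 2) (Fin 2) k) 1 0 = 0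
      simp⟩
    obtain ⟨s, b', h⟩ := big (u.1 * g) (by
      rw [SLn.mul_val]
      simpa [u, Matrix.mul_apply, Fin.sum_univ_two, hg] using hc)
    exact ⟨u⁻¹, s, b', by simp [mul_assoc, ← h]⟩
  · obtain ⟨s, b', h⟩ := big g hg
    exact ⟨1, s, b', by simpa using h⟩

theorem IsSLHom.map_one {k : Type*} [Field k] {n : ℕ} {σ : SLn 2 k → SLn n k} (hσ : IsSLHom σ) :
    σ 1 = 1 := by
  have h := hσ.map_mul 1 1
  simpa using h

theorem IsSLHom.map_inv {k : Type*} [Field k] {n : ℕ} {σ : SLn 2 k → SLn n k} (hσ : IsSLHom σ)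
    (g : SLn 2 k) : σ g⁻¹ = (σ g)⁻¹ := by
  refine eq_inv_of_mul_eq_one_left ?_
  rw [← hσ.map_mul, inv_mul_cancel, hσ.map_one]

open Polynomial in
/-- The entries of `g ↦ τ(g) σ(g)⁻¹` are polynomial along a curve `γ` in `SL(2, k)` such that `γ`
and its inverse have polynomial entries. -/
theorem IsSLHom.exists_polynomial_mul_inv {k : Type*} [Field k] {n : ℕ} {σ τ : SLn 2 k → SLn n k}
    (hσ : IsSLHom σ) (hτ : IsSLHom τ) (γ : k → SLn 2 k) (M N : Matrix (Fin 2) (Fin 2) k[X])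
    (hM : ∀ s, (γ s).1 = M.map (Polynomial.eval s))
    (hN : ∀ s, ((γ s)⁻¹).1 = N.map (Polynomial.eval s)) (i j : Fin n) :
    ∃ Q : k[X], ∀ s, (τ (γ s) * (σ (γ s))⁻¹).1 i j = Q.eval s := by
  choose P hP using fun l => hτ.regular.exists_polynomial M i l
  choose R hR using fun l => hσ.regular.exists_polynomial N l j
  refine ⟨∑ l, P l * R l, fun s => ?_⟩
  -- Evaluating σ on the inverse curve keeps the entries polynomial without inverting an n × n
  -- matrix.
  rw [← hσ.map_inv, Polynomial.eval_finsetSum]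
  change ((τ (γ s)).1 * (σ (γ s)⁻¹).1) i j = _
  rw [Matrix.mul_apply]
  exact Finset.sum_congr rfl fun l _ => by
    rw [Polynomial.eval_mul, hP l _ s (hM s), hR l _ s (hN s)]

open Polynomial in
/-- A homomorphism of algebraic groups on `SL(2, k)` is determined by its restriction to the Borel
subgroup. -/
theorem IsSLHom.eq_of_eq_on_borel {k : Type*} [Field k] [Infinite k] {n : ℕ}
    {σ τ : SLn 2 k → SLn n k} (hσ : IsSLHom σ) (hτ : IsSLHom τ)
    (h : ∀ b : borelSL2 k, τ b.1 = σ b.1) : τ = σ := by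
  have hlow : ∀ s, τ (lowerUnipotent s) = σ (lowerUnipotent s) := by
    intro s
    rw [← mul_inv_eq_one]
    have h0 : τ (lowerUnipotent 0) * (σ (lowerUnipotent 0))⁻¹ = 1 := by
      have : lowerUnipotent (0 : k) = 1 := by
        ext i j
        fin_cases i <;> fin_cases j <;> simp [lowerUnipotent]
      rw [this, hσ.map_one, hτ.map_one, mul_inv_cancel]
    rw [← h0]
    ext i j
    obtain ⟨Q, hQ⟩ := hσ.exists_polynomial_mul_inv hτ lowerUnipotent !![1, 0; X, 1] !![1, 0; -X, 1]
      (fun s => by ext i j; fin_cases i <;> fin_cases j <;> simp [lowerUnipotent])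
      (fun s => by
        rw [lowerUnipotent_inv]; ext i j; fin_cases i <;> fin_cases j <;> simp [lowerUnipotent])
      i j
    obtain ⟨R, hR⟩ := hσ.exists_polynomial_mul_inv hτ weylChart !![X, -1; 1, 0] !![0, 1; -1, X]
      (fun s => by ext i j; fin_cases i <;> fin_cases j <;> simp [weylChart])
      (fun s => by
        rw [SLn.inv_val_two]
        ext i j; fin_cases i <;> fin_cases j <;> simp [weylChart])
      i j
    refine (hQ s).trans ((Polynomial.eval_eq_of_eval_inv (r := R) (fun s hs => ?_) s).trans
      (hQ 0).symm)
    obtain ⟨b, hb⟩ := lowerUnipotent_mem_mul_borel hs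
    -- Right invariance: the factors τ(b) and σ(b)⁻¹ cancel, so both charts give the same value.
    rw [← hQ, ← hR, hb, hσ.map_mul, hτ.map_mul, h b]
    group
  funext g
  obtain ⟨b, s, b', rfl⟩ := exists_borel_mul_lowerUnipotent_mul_borel g
  rw [hσ.map_mul, hσ.map_mul, hτ.map_mul, hτ.map_mul, h, h, hlow]

/-! ### Frobenius powers and constants in characteristic p -/

theorem frobenius_det_eq_one {k : Type*} [Field k] (p : ℕ) [Fact p.Prime] [CharP k p] (e : ℕ)
    {a b c d : k} (h : a * d - b * c = 1) :
    a ^ p ^ e * d ^ p ^ e - b ^ p ^ e * c ^ p ^ e = 1 := by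
  rw [← mul_pow, ← mul_pow, ← sub_pow_char_pow, h, one_pow]

theorem pow_char_pow_succ {k : Type*} [Monoid k] (p : ℕ) (x : k) (e : ℕ) :
    x ^ p ^ (e + 1) = (x ^ p ^ e) ^ p := by
  rw [pow_succ, pow_mul]

theorem natCast_ne_zero_of_lt_char (k : Type*) [Field k] (p : ℕ) [CharP k p] {n : ℕ}
    (h0 : 0 < n) (h : n < p) : (n : k) ≠ 0 := fun hn =>
  absurd (Nat.le_of_dvd h0 ((CharP.cast_eq_zero_iff k p n).1 hn)) (by omega)

/-- Lets forms II and VII be checked as polynomial identities with integer coefficients modulo 3. -/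
theorem one_half_eq_two_of_char_three (k : Type*) [Field k] [CharP k 3] : (1 / 2 : k) = 2 := by
  have n2 : (2 : k) ≠ 0 := mod_cast natCast_ne_zero_of_lt_char k 3 (n := 2) (by omega) (by omega)
  have h3 : (3 : k) = 0 := mod_cast CharP.cast_eq_zero k 3
  rw [div_eq_iff n2]
  linear_combination -h3

/-! ### Multiplicativity and determinant of σ* -/

namespace BForm

set_option maxHeartbeats 2000000 in
/-- `σ*` is multiplicative. -/
theorem sigmaMatrix_mul {k : Type*} [Field k] {p : ℕ} [Fact p.Prime] [CharP k p]
    (β : BForm p) (hβ : β.IsStarForm) {a b c d a' b' c' d' : k}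
    (h : a * d - b * c = 1) (h' : a' * d' - b' * c' = 1) :
    β.sigmaMatrix (a * a' + b * c') (a * b' + b * d') (c * a' + d * c') (c * b' + d * d') =
      β.sigmaMatrix a b c d * β.sigmaMatrix a' b' c' d' := by
  have hF := fun e => frobenius_det_eq_one p e h
  have hF' := fun e => frobenius_det_eq_one p e h'
  -- Needed to distribute the q-th power over the factors ad + 2bc and ad + bc/2 of form I: elements
  -- of the prime field are fixed by Frobenius.
  have h2 : ∀ e, (2 : k) ^ p ^ e = 2 := fun e => map_ofNat (iterateFrobenius k p e) 2
  have hchar := CharP.cast_eq_zero k p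
  have h2p : ∀ n, 0 < n → n < p → (n : k) ≠ 0 := fun n => natCast_ne_zero_of_lt_char k p
  cases β with
  | I e hp =>
    have n2 : (2 : k) ≠ 0 := mod_cast h2p 2 (by omega) (by omega)
    have n3 : (3 : k) ≠ 0 := mod_cast h2p 3 (by omega) (by omega)
    -- All denominators are expressed through 1/2 and 1/3, whose only needed properties are `e2` and
    -- `e3`.
    have e1 : (1 / 6 : k) = 1 / 2 * (1 / 3) := by
      rw [one_div_mul_one_div]
      norm_num
    have e2 : (2 : k) * (1 / 2) = 1 := by field_simp
    have e3 : (3 : k) * (1 / 3) = 1 := by field_simp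
    replace hF := hF e
    replace hF' := hF' e
    simp only [sigmaMatrix, pow_mul' _ _ (p ^ _), mul_pow, add_pow_char_pow, h2, div_pow, one_pow,
      e1]
    ext r s
    fin_cases r <;> fin_cases s <;> simp [Matrix.mul_apply, Fin.sum_univ_four] <;> grind
  | II e hp =>
    simp only [sigmaMatrix]
    clear hβ
    subst hp
    have e2 := one_half_eq_two_of_char_three k
    replace hF := hF e
    replace hF' := hF' e
    simp only [pow_char_pow_succ, pow_mul' _ _ (3 ^ _), mul_pow, add_pow_char_pow, e2]
    ext r s
    fin_cases r <;> fin_cases s <;> simp [Matrix.mul_apply, Fin.sum_univ_four] <;> grind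
  -- A tensor product of two Frobenius twists of the standard representation: no determinant
  -- relation is needed.
  | IV e₁ e₂ he =>
    simp only [sigmaMatrix, mul_pow, add_pow_char_pow]
    ext r s
    fin_cases r <;> fin_cases s <;> simp [Matrix.mul_apply, Fin.sum_univ_four] <;> ring
  -- In characteristic 2, AD + BC = AD - BC = 1. This collapses the middle coefficient of the
  -- symmetric square and accounts for the constant entries 1 here and in XI, XIX, XXI.
  | V e f hf =>
    obtain ⟨rfl, rfl⟩ := hβ
    replace hF := hF e
    replace hF' := hF' e
    simp only [sigmaMatrix, pow_char_pow_succ, mul_pow, add_pow_char_pow]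
    ext r s
    fin_cases r <;> fin_cases s <;> simp [Matrix.mul_apply, Fin.sum_univ_four] <;> grind
  | VII e hp =>
    simp only [sigmaMatrix]
    clear hβ
    subst hp
    have e2 := one_half_eq_two_of_char_three k
    replace hF := hF e
    replace hF' := hF' e
    simp only [pow_char_pow_succ, pow_mul' _ _ (3 ^ _), mul_pow, add_pow_char_pow, e2]
    ext r s
    fin_cases r <;> fin_cases s <;> simp [Matrix.mul_apply, Fin.sum_univ_four] <;> grind
  | IX e hp =>
    have n2 : (2 : k) ≠ 0 := mod_cast h2p 2 (by omega) (by omega)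
    have e2 : (2 : k) * (1 / 2) = 1 := by field_simp
    replace hF := hF e
    replace hF' := hF' e
    simp only [sigmaMatrix, pow_mul' _ _ (p ^ _), mul_pow, add_pow_char_pow]
    ext r s
    fin_cases r <;> fin_cases s <;> simp [Matrix.mul_apply, Fin.sum_univ_four] <;> grind
  | XI e f hf =>
    obtain ⟨rfl, rfl⟩ := hβ
    replace hF := hF e
    replace hF' := hF' e
    simp only [sigmaMatrix, pow_mul' _ _ (2 ^ _), mul_pow, add_pow_char_pow]
    ext r s
    fin_cases r <;> fin_cases s <;> simp [Matrix.mul_apply, Fin.sum_univ_four] <;> grind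
  | XIX e f hf =>
    obtain ⟨rfl, rfl⟩ := hβ
    replace hF := hF e
    replace hF' := hF' e
    simp only [sigmaMatrix, pow_mul' _ _ (2 ^ _), mul_pow, add_pow_char_pow]
    ext r s
    fin_cases r <;> fin_cases s <;> simp [Matrix.mul_apply, Fin.sum_univ_four] <;> grind
  | XXI e hp =>
    simp only [sigmaMatrix]
    clear hβ
    subst hp
    replace hF := hF e
    replace hF' := hF' e
    simp only [pow_mul' _ _ (2 ^ _), mul_pow, add_pow_char_pow]
    ext r s
    fin_cases r <;> fin_cases s <;> simp [Matrix.mul_apply, Fin.sum_univ_four] <;> grind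
  | XXVI => simp [sigmaMatrix]
  -- XV, XXII and XXIV are direct sums of Frobenius twists of the standard representation and
  -- trivial ones.
  | _ =>
    simp only [sigmaMatrix, mul_pow, add_pow_char_pow]
    ext r s
    fin_cases r <;> fin_cases s <;> simp [Matrix.mul_apply, Fin.sum_univ_four]

/-- `σ*` takes values in `SL(4, k)`. -/
theorem det_sigmaMatrix {k : Type*} [Field k] {p : ℕ} [Fact p.Prime] [CharP k p]
    (β : BForm p) (hβ : β.IsStarForm) {a b c d : k} (h : a * d - b * c = 1) :
    (β.sigmaMatrix a b c d).det = 1 := by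
  have hF := fun e => frobenius_det_eq_one p e h
  have h2 : ∀ e, (2 : k) ^ p ^ e = 2 := fun e => map_ofNat (iterateFrobenius k p e) 2
  have hchar := CharP.cast_eq_zero k p
  have h2p : ∀ n, 0 < n → n < p → (n : k) ≠ 0 := fun n => natCast_ne_zero_of_lt_char k p
  cases β with
  | I e hp =>
    have n2 : (2 : k) ≠ 0 := mod_cast h2p 2 (by omega) (by omega)
    have n3 : (3 : k) ≠ 0 := mod_cast h2p 3 (by omega) (by omega)
    have e1 : (1 / 6 : k) = 1 / 2 * (1 / 3) := by
      rw [one_div_mul_one_div]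
      norm_num
    have e2 : (2 : k) * (1 / 2) = 1 := by field_simp
    have e3 : (3 : k) * (1 / 3) = 1 := by field_simp
    replace hF := hF e
    simp only [sigmaMatrix, pow_mul' _ _ (p ^ _), mul_pow, add_pow_char_pow, h2, div_pow, one_pow,
      e1]
    simp [Matrix.det_succ_row_zero, Fin.sum_univ_succ, Fin.succAbove]
    grind
  | II e hp =>
    simp only [sigmaMatrix]
    clear hβ
    subst hp
    have e2 := one_half_eq_two_of_char_three k
    replace hF := hF e
    simp only [pow_char_pow_succ, pow_mul' _ _ (3 ^ _), e2]
    simp [Matrix.det_succ_row_zero, Fin.sum_univ_succ, Fin.succAbove]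
    grind
  | IV e₁ e₂ he =>
    have hF₁ := hF e₁
    have hF₂ := hF e₂
    simp only [sigmaMatrix]
    simp [Matrix.det_succ_row_zero, Fin.sum_univ_succ, Fin.succAbove]
    grind
  | XV e₁ e₂ he =>
    have hF₁ := hF e₁
    have hF₂ := hF e₂
    simp only [sigmaMatrix]
    simp [Matrix.det_succ_row_zero, Fin.sum_univ_succ, Fin.succAbove]
    grind
  | V e f hf =>
    obtain ⟨rfl, rfl⟩ := hβ
    replace hF := hF e
    simp only [sigmaMatrix, pow_char_pow_succ]
    simp [Matrix.det_succ_row_zero, Fin.sum_univ_succ, Fin.succAbove]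
    grind
  | VII e hp =>
    simp only [sigmaMatrix]
    clear hβ
    subst hp
    have e2 := one_half_eq_two_of_char_three k
    replace hF := hF e
    simp only [pow_char_pow_succ, pow_mul' _ _ (3 ^ _), e2]
    simp [Matrix.det_succ_row_zero, Fin.sum_univ_succ, Fin.succAbove]
    grind
  | IX e hp =>
    have n2 : (2 : k) ≠ 0 := mod_cast h2p 2 (by omega) (by omega)
    have e2 : (2 : k) * (1 / 2) = 1 := by field_simp
    replace hF := hF e
    simp only [sigmaMatrix, pow_mul' _ _ (p ^ _)]
    simp [Matrix.det_succ_row_zero, Fin.sum_univ_succ, Fin.succAbove]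
    grind
  | XI e f hf =>
    obtain ⟨rfl, rfl⟩ := hβ
    replace hF := hF e
    simp only [sigmaMatrix, pow_mul' _ _ (2 ^ _)]
    simp [Matrix.det_succ_row_zero, Fin.sum_univ_succ, Fin.succAbove]
    grind
  | XIX e f hf =>
    obtain ⟨rfl, rfl⟩ := hβ
    replace hF := hF e
    simp only [sigmaMatrix, pow_mul' _ _ (2 ^ _)]
    simp [Matrix.det_succ_row_zero, Fin.sum_univ_succ, Fin.succAbove]
    grind
  | XXI e hp =>
    simp only [sigmaMatrix]
    clear hβ
    subst hp
    replace hF := hF e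
    simp only [pow_mul' _ _ (2 ^ _)]
    simp [Matrix.det_succ_row_zero, Fin.sum_univ_succ, Fin.succAbove]
    grind
  | XXII e | XXIV e =>
    replace hF := hF e
    simp only [sigmaMatrix]
    simp [Matrix.det_succ_row_zero, Fin.sum_univ_succ, Fin.succAbove]
    grind
  | XXVI => simp [sigmaMatrix]

end BForm

/-! ### Regularity of σ* -/

/-- A function on `X` that is a polynomial in the entries of the matrix `c x`. -/
def IsRegularFun {k : Type*} [Field k] {X : Type*} {m : ℕ} (c : X → Matrix (Fin m) (Fin m) k)
    (f : X → k) : Prop :=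
  ∃ P : MvPolynomial (Fin m × Fin m) k, ∀ x, f x = MvPolynomial.eval (fun q => c x q.1 q.2) P

namespace IsRegularFun

variable {k : Type*} [Field k] {X : Type*} {m : ℕ} {c : X → Matrix (Fin m) (Fin m) k} {f g : X → k}

theorem const (r : k) : IsRegularFun c fun _ => r :=
  ⟨MvPolynomial.C r, by simp⟩

theorem entry (i j : Fin m) : IsRegularFun c fun x => c x i j :=
  ⟨MvPolynomial.X (i, j), by simp⟩

theorem add (hf : IsRegularFun c f) (hg : IsRegularFun c g) :
    IsRegularFun c fun x => f x + g x := by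
  obtain ⟨P, hP⟩ := hf
  obtain ⟨Q, hQ⟩ := hg
  exact ⟨P + Q, by simp [hP, hQ]⟩

theorem mul (hf : IsRegularFun c f) (hg : IsRegularFun c g) :
    IsRegularFun c fun x => f x * g x := by
  obtain ⟨P, hP⟩ := hf
  obtain ⟨Q, hQ⟩ := hg
  exact ⟨P * Q, by simp [hP, hQ]⟩

theorem pow (hf : IsRegularFun c f) (e : ℕ) : IsRegularFun c fun x => f x ^ e := by
  obtain ⟨P, hP⟩ := hf
  exact ⟨P ^ e, by simp [hP]⟩

end IsRegularFun

namespace BForm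

/-- Each entry is built from constants and a, b, c, d by sums, products and natural powers, and the
proof follows that syntax. -/
theorem isRegularFun_sigmaMatrix {k : Type*} [Field k] {p : ℕ} (β : BForm p) (i j : Fin 4) :
    IsRegularFun (fun A : SLn 2 k => A.1)
      fun A => β.sigmaMatrix (A.1 0 0) (A.1 0 1) (A.1 1 0) (A.1 1 1) i j := by
  cases β
  case XXVI => exact .const _
  all_goals
    fin_cases i <;> fin_cases j <;>
    · simp only [sigmaMatrix]
      repeat' first
        | exact .const _
        | exact .entry _ _
        | apply IsRegularFun.add
        | apply IsRegularFun.mul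
        | apply IsRegularFun.pow

/-! ### Restriction of σ* to the Borel subgroup -/

/-- The units x and y are left free so that each form can supply its weights as explicit expressions
in powers u^q, which removes the integer exponents before the entries are compared. -/
theorem psi_jmath {k : Type*} [Field k] {p : ℕ} (β : BForm p) (t : k) (u : kˣ) {x y : kˣ}
    (hx : u ^ β.d₁ = x) (hy : u ^ β.d₂ = y) :
    (β.psi (jmath k (t, u))).1 =
      β.phiMatrix t * Matrix.diagonal ![(x : k), y, (y : k)⁻¹, (x : k)⁻¹] := by
  have h : (β.psi (jmath k (t, u))).1 = β.phiMatrix t * (omega β.d₁ β.d₂ u).1 := by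
    simp only [psi, Function.comp_apply, Equiv.symm_apply_apply]
    rfl
  rw [h, omega]
  simp only [zpow_neg, hx, hy, Units.val_inv_eq_inv_val]

set_option maxHeartbeats 2000000 in
/-- The restriction of `σ*` to the Borel subgroup is `ψ*`, in the coordinates `(t, u)`. -/
theorem sigmaMatrix_eq_psi_jmath {k : Type*} [Field k] {p : ℕ} [Fact p.Prime] [CharP k p]
    (β : BForm p) (hβ : β.IsStarForm) (t : k) (u : kˣ) :
    β.sigmaMatrix (u : k) (t * (u : k)⁻¹) 0 (u : k)⁻¹ = (β.psi (jmath k (t, u))).1 := by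
  have h0 : ∀ e, (0 : k) ^ p ^ e = 0 := fun e =>
    zero_pow (pow_ne_zero e (Fact.out : p.Prime).ne_zero)
  have hz : ∀ e : ℕ, u ^ ((p : ℤ) ^ e) = u ^ p ^ e := fun e => by
    rw [← Nat.cast_pow, zpow_natCast]
  have hz' : ∀ (m : ℤ) (e : ℕ), u ^ (m * (p : ℤ) ^ e) = (u ^ p ^ e) ^ m := fun m e => by
    rw [zpow_mul', hz]
  -- The prime stays a variable; only the outer exponent p is replaced by its numerical value, so
  -- that p^(e+1)-th powers become squares or cubes of q-th powers.
  have hs : ∀ {M : Type _} [Monoid M] (n : ℕ) (x : M) (e : ℕ), p = n →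
      x ^ p ^ (e + 1) = (x ^ p ^ e) ^ n := fun n x e h => by
    rw [pow_char_pow_succ, h]
  cases β with
  | I e hp =>
    rw [psi_jmath (x := (u ^ p ^ e) ^ 3) (y := u ^ p ^ e) _ _ _ (hz' 3 e) (hz e)]
    simp only [sigmaMatrix, phiMatrix, mul_pow, inv_pow, pow_mul' _ _ (p ^ _), h0,
      Units.val_pow_eq_pow_val]
    ext i j
    fin_cases i <;> fin_cases j <;> simp <;> field_simp
  | II e hp =>
    rw [psi_jmath (x := (u ^ p ^ e) ^ 3) (y := u ^ p ^ e) _ _ _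
      ((hz _).trans (hs 3 u e hp)) (hz e)]
    simp only [sigmaMatrix, phiMatrix, mul_pow, inv_pow, pow_mul' _ _ (p ^ _), hs 3 _ _ hp,
      h0, Units.val_pow_eq_pow_val]
    ext i j
    fin_cases i <;> fin_cases j <;> simp <;> field_simp
  | VII e hp =>
    rw [psi_jmath (x := (u ^ p ^ e) ^ 3) (y := u ^ p ^ e) _ _ _
      ((hz _).trans (hs 3 u e hp)) (hz e)]
    simp only [sigmaMatrix, phiMatrix, mul_pow, inv_pow, pow_mul' _ _ (p ^ _), hs 3 _ _ hp,
      h0, Units.val_pow_eq_pow_val]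
    ext i j
    fin_cases i <;> fin_cases j <;> simp <;> field_simp
  | IV e₁ e₂ he =>
    rw [psi_jmath (x := u ^ p ^ e₁ * u ^ p ^ e₂) (y := u ^ p ^ e₂ * (u ^ p ^ e₁)⁻¹) _ _ _
      (by rw [d₁, _root_.zpow_add, hz, hz]) (by rw [d₂, zpow_sub, hz, hz])]
    simp only [sigmaMatrix, phiMatrix, mul_pow, inv_pow, pow_add, h0,
      Units.val_pow_eq_pow_val, Units.val_mul, Units.val_inv_eq_inv_val]
    ext i j
    fin_cases i <;> fin_cases j <;> simp <;> field_simp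
  | IX e hp =>
    rw [psi_jmath (x := (u ^ p ^ e) ^ 2) (y := 1) _ _ _ (hz' 2 e) (zpow_zero u)]
    simp only [sigmaMatrix, phiMatrix, mul_pow, inv_pow, pow_mul' _ _ (p ^ _), h0,
      Units.val_one]
    ext i j
    fin_cases i <;> fin_cases j <;> simp <;> field_simp
  | XXI e hp =>
    rw [psi_jmath (x := (u ^ p ^ e) ^ 2) (y := 1) _ _ _
      ((hz _).trans (hs 2 u e hp)) (zpow_zero u)]
    simp only [sigmaMatrix, phiMatrix, mul_pow, inv_pow, pow_mul' _ _ (p ^ _), hs 2 _ _ hp,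
      h0, Units.val_pow_eq_pow_val, Units.val_one]
    ext i j
    fin_cases i <;> fin_cases j <;> simp <;> field_simp
  | V e f hf | XI e f hf | XIX e f hf =>
    obtain ⟨hp, rfl⟩ := hβ
    -- The middle weight vanishes exactly because p = 2.
    have hd : (p : ℤ) ^ (e + 1) - 2 * (p : ℤ) ^ e = 0 := by
      rw [pow_succ, show (p : ℤ) = 2 by exact_mod_cast hp]
      ring
    rw [psi_jmath (x := (u ^ p ^ e) ^ 2) (y := 1) _ _ _ ((hz _).trans (hs 2 u e hp))
      (by rw [d₂, hd, zpow_zero])]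
    simp only [sigmaMatrix, phiMatrix, mul_pow, inv_pow, pow_mul' _ _ (p ^ _), hs 2 _ _ hp,
      h0, Units.val_pow_eq_pow_val, Units.val_one]
    ext i j
    fin_cases i <;> fin_cases j <;> simp <;> field_simp
  | XV e₂ e₃ he =>
    rw [psi_jmath (x := u ^ p ^ e₂) (y := u ^ p ^ e₃) _ _ _ (hz e₂) (hz e₃)]
    simp only [sigmaMatrix, phiMatrix, mul_pow, inv_pow, h0, Units.val_pow_eq_pow_val]
    ext i j
    fin_cases i <;> fin_cases j <;> simp
  | XXII e m hd hd' =>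
    have hm : m = (p : ℤ) ^ e := hβ
    rw [psi_jmath (x := u ^ p ^ e) (y := u ^ p ^ e) _ _ _ (by rw [d₁, hm, hz])
      (by rw [d₂, hm, two_mul, add_sub_cancel_right, hz])]
    simp only [sigmaMatrix, phiMatrix, mul_pow, inv_pow, h0, Units.val_pow_eq_pow_val]
    ext i j
    fin_cases i <;> fin_cases j <;> simp
  | XXIV e m hd hd' =>
    have hm : m = 0 := hβ
    rw [psi_jmath (x := u ^ p ^ e) (y := 1) _ _ _ (hz e) (by rw [d₂, hm, zpow_zero])]
    simp only [sigmaMatrix, phiMatrix, mul_pow, inv_pow, h0,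
      Units.val_pow_eq_pow_val, Units.val_one]
    ext i j
    fin_cases i <;> fin_cases j <;> simp
  | XXVI m₁ m₂ hd hd' =>
    obtain ⟨rfl, rfl⟩ := hβ
    rw [psi_jmath (x := 1) (y := 1) _ _ _ (zpow_zero u) (zpow_zero u)]
    ext i j
    fin_cases i <;> fin_cases j <;> simp [sigmaMatrix, phiMatrix]

theorem sigmaMatrix_eq_psi {k : Type*} [Field k] {p : ℕ} [Fact p.Prime] [CharP k p]
    (β : BForm p) (hβ : β.IsStarForm) (A : borelSL2 k) :
    β.sigmaMatrix (A.1.1 0 0) (A.1.1 0 1) (A.1.1 1 0) (A.1.1 1 1) = (β.psi A).1 := by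
  obtain ⟨⟨t, u⟩, rfl⟩ := (jmath k).surjective A
  rw [← sigmaMatrix_eq_psi_jmath β hβ]
  simp [jmath]

end BForm

/-! ### Existence and uniqueness of the extension -/

theorem theorem5p25 {k : Type*} [Field k] [IsAlgClosed k] (p : ℕ) [Fact p.Prime] [CharP k p]
    (β : BForm p) (hβ : β.IsStarForm) :
    IsBorelHom (β.psi : borelSL2 k → SLn 4 k) ∧
    (∃ σ : SLn 2 k → SLn 4 k, IsSLHom σ ∧
      (∀ A : SLn 2 k, (σ A).1 = β.sigmaMatrix (A.1 0 0) (A.1 0 1) (A.1 1 0) (A.1 1 1)) ∧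
      ∀ A : borelSL2 k, σ A.1 = β.psi A) ∧
    ∃! τ : SLn 2 k → SLn 4 k, IsSLHom τ ∧ ∀ A : borelSL2 k, τ A.1 = β.psi A := by
  have hdet : ∀ A : SLn 2 k, A.1 0 0 * A.1 1 1 - A.1 0 1 * A.1 1 0 = 1 := fun A =>
    (Matrix.det_fin_two A.1).symm.trans A.2
  let σ : SLn 2 k → SLn 4 k := fun A =>
    ⟨β.sigmaMatrix (A.1 0 0) (A.1 0 1) (A.1 1 0) (A.1 1 1), β.det_sigmaMatrix hβ (hdet A)⟩
  have hσ : IsSLHom σ := by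
    refine ⟨fun A B => Subtype.ext ?_, ?_⟩
    · refine Eq.trans ?_ (β.sigmaMatrix_mul hβ (hdet A) (hdet B))
      simp only [σ, SLn.mul_val, Matrix.mul_apply, Fin.sum_univ_two]
    · choose P hP using fun i j => β.isRegularFun_sigmaMatrix (k := k) i j
      exact ⟨P, fun A i j => hP i j A⟩
  have hσψ : ∀ A : borelSL2 k, σ A.1 = β.psi A := fun A =>
    Subtype.ext (β.sigmaMatrix_eq_psi hβ A)
  have : Infinite k := IsAlgClosed.instInfinite
  refine ⟨⟨fun A B => ?_, ?_⟩, ⟨σ, hσ, fun _ => rfl, hσψ⟩, σ, ⟨hσ, hσψ⟩, ?_⟩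
  -- Both properties of ψ* are inherited from σ*, whose restriction it is.
  · rw [← hσψ, ← hσψ, ← hσψ, ← hσ.map_mul]
    rfl
  · obtain ⟨P, hP⟩ := hσ.regular
    exact ⟨P, fun A i j => by rw [← hσψ, hP]⟩
  · rintro τ ⟨hτ, hτψ⟩
    exact hσ.eq_of_eq_on_borel hτ fun b => (hτψ b).trans (hσψ b).symm
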